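/- Let $\mathbf A$ be a complete deterministic finite automaton over an alphabet $\Sigma$ (every letter acts on every state) that is reduced (every state is reachable from the initial state, and distinct states are inequivalent). For $k\ge 1$, $\mathbf A$ is called $k$-testable if, for all nonempty words $u,v\in\Sigma^+$ that have the same prefix of length $k-1$, the same suffix of length $k-1$ (a word shorter than $k-1$ being its own prefix and suffix) and the same set of factors of length $k$, $\mathbf A$ accepts $u$ if and only if it accepts $v$. $\mathbf A$ is locally testable if it is $k$-testable for some $k\ge 1$, and precisely $n$-testable if $n$ is the least such $k$. Write $p\succeq q$ if the state $q$ is reachable from the state $p$ (possibly by the empty word). An SCC is a maximal strongly connected component of the state transition graph. The 2-tuple graph has as nodes the pairs $(p,q)$ of distinct states with $p\succeq q$, and an edge $(p,q)\to(p\sigma,q\sigma)$ for each letter $\sigma$ for which both pairs are nodes. The length of a path is its number of edges; length $0$ is allowed. A path on this graph with nodes $(p_1,q_1),\dots,(p_s,q_s)$ is called * SCC-restricted if all $p_i$ and $q_i$ belong to one SCC; * SCC-semirestricted if for some letter $\sigma$ we have $p_s\sigma\not\succeq q_s\sigma$ and $q_s\sigma\succeq q_1$; * $r$-periodic ($r\ge1$)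 if $p_{i+r}=q_i$ whenever $1\le i\le s-r$, and for each $j$ there is a letter $\sigma$ with $(p_{j+ri}\sigma,q_{j+ri}\sigma)=(p_{j+ri+1},q_{j+ri+1})$ for all $i\ge0$ with $j+ri<s$. Theorem. Suppose that $\mathbf A$ is locally testable. Let $k$ be the maximal integer $k\ge0$ such that for some $r\ge1$ there is an $r$-periodic path of length $k+r$, let $l$ be the maximal length of an SCC-restricted path, and let $m$ be the maximal length of an SCC-semirestricted path. The three sets of numbers whose maxima are taken here are finite. If at least one of them is non-empty, then $\mathbf A$ is precisely $(\max(k,l,m)+2)$-testable, where the maximum of an empty set is counted as $0$. If all three are empty, then $\mathbf A$ is precisely $1$-testable. -/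

import Mathlib

/-! ### `k`-testable languages and the order of local testability -/

/-- `SameKProfile k u v`: the words `u` and `v` have the same prefix of length `k - 1`, the same
suffix of length `k - 1` (a shorter word being its own prefix and suffix), and the same set of
factors of length `k`. -/
def SameKProfile {α : Type*} (k : ℕ) (u v : List α) : Prop :=
  u.take (k - 1) = v.take (k - 1) ∧
  u.rtake (k - 1) = v.rtake (k - 1) ∧
  {x : List α | x <:+: u ∧ x.length = k} = {x : List α | x <:+: v ∧ x.length = k}

/-- A language is `k`-testable, for a positive integer `k`, if membership of a nonempty word is
determined by its prefix and suffix of length `k - 1` and its set of factors of length `k`. -/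
def Language.IsKTestable {α : Type*} (L : Language α) (k : ℕ) : Prop :=
  0 < k ∧ ∀ u v : List α, u ≠ [] → v ≠ [] → SameKProfile k u v → (u ∈ L ↔ v ∈ L)

namespace DFA

variable {α σ : Type*}

/-- An automaton is `k`-testable if it accepts a `k`-testable language. -/
def IsKTestable (M : DFA α σ) (k : ℕ) : Prop := M.accepts.IsKTestable k

/-- An automaton is locally testable if it is `k`-testable for some `k`. -/
def IsLocallyTestable (M : DFA α σ) : Prop := ∃ k, M.IsKTestable k

/-- An automaton is precisely `n`-testable if `n` is the least `k` for which it is `k`-testable,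
that is, its order of local testability is `n`. -/
def IsPreciselyTestable (M : DFA α σ) (n : ℕ) : Prop := IsLeast {k | M.IsKTestable k} n

/-- An automaton is reduced if every state is reachable from the initial state, and no two
distinct states are equivalent. -/
def IsReduced (M : DFA α σ) : Prop :=
  (∀ q : σ, ∃ w : List α, M.eval w = q) ∧ Function.Injective M.acceptsFrom

/-! ### The state transition graph and the 2-tuple graph -/

/-- `q` is reachable from `p` in the state transition graph (possibly by the empty word). -/
def Reaches (M : DFA α σ) (p q : σ) : Prop := ∃ w : List α, M.evalFrom p w = q

/-- `p` and `q` belong to one strongly connected component of the state transition graph. -/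
def SameSCC (M : DFA α σ) (p q : σ) : Prop := M.Reaches p q ∧ M.Reaches q p

/-- The nodes of the 2-tuple graph: pairs of distinct states, the second of which is reachable
from the first. -/
def IsNode (M : DFA α σ) (x : σ × σ) : Prop := M.Reaches x.1 x.2 ∧ x.1 ≠ x.2

/-- The componentwise action of a letter on pairs of states. -/
def pairStep (M : DFA α σ) (x : σ × σ) (c : α) : σ × σ := (M.step x.1 c, M.step x.2 c)

/-- `x 0, x 1, …, x n` are the successive nodes of a path of length `n` (that is, with `n` edges)
on the 2-tuple graph. The values of `x` beyond `n` play no role. -/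
def IsPath (M : DFA α σ) (n : ℕ) (x : ℕ → σ × σ) : Prop :=
  (∀ i ≤ n, M.IsNode (x i)) ∧ ∀ i < n, ∃ c : α, M.pairStep (x i) c = x (i + 1)

/-- An SCC-restricted path of length `n`: all components of all its nodes belong to one strongly
connected component of the state transition graph. -/
def IsSCCRestrictedPath (M : DFA α σ) (n : ℕ) (x : ℕ → σ × σ) : Prop :=
  M.IsPath n x ∧
  ∃ s : σ, ∀ i ≤ n, M.SameSCC s (x i).1 ∧ M.SameSCC s (x i).2

/-- An SCC-semirestricted path of length `n`: some letter `c` sends the last node `(p, q)` of the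
path to a pair `(pc, qc)` such that `qc` is not reachable from `pc`, while the second component of
the first node of the path is reachable from `qc`. -/
def IsSCCSemirestrictedPath (M : DFA α σ) (n : ℕ) (x : ℕ → σ × σ) : Prop :=
  M.IsPath n x ∧
  ∃ c : α, ¬ M.Reaches (M.step (x n).1 c) (M.step (x n).2 c) ∧
    M.Reaches (M.step (x n).2 c) (x 0).2

/-- An `r`-periodic path of length `n`: the first component of the node number `i + r` is the
second component of the node number `i`, and edges whose positions are congruent modulo `r` can
be given a common label. -/
def IsPeriodicPath (M : DFA α σ) (r n : ℕ) (x : ℕ → σ × σ) : Prop :=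
  0 < r ∧ M.IsPath n x ∧
  (∀ i, i + r ≤ n → (x (i + r)).1 = (x i).2) ∧
  ∀ j < n, ∃ c : α, ∀ i, j + r * i < n → M.pairStep (x (j + r * i)) c = x (j + r * i + 1)

/-- The numbers `k` such that, for some `r`, there is an `r`-periodic path of length `k + r`. -/
def periodicExcesses (M : DFA α σ) : Set ℕ := {k | ∃ r x, M.IsPeriodicPath r (k + r) x}

/-- The lengths of SCC-restricted paths. -/
def restrictedLengths (M : DFA α σ) : Set ℕ := {l | ∃ x, M.IsSCCRestrictedPath l x}

/-- The lengths of SCC-semirestricted paths. -/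
def semirestrictedLengths (M : DFA α σ) : Set ℕ := {m | ∃ x, M.IsSCCSemirestrictedPath m x}

end DFA

/-! ### Walks in a deterministic labelled graph -/

section Walks

variable {α σ V : Type*}

/-! Everything rests on one equivalence, `IsReduced.isKTestable_succ_iff`: a reduced automaton is
`(n + 1)`-testable exactly when `n` is not the value of a path of any of the three kinds. Since each
kind of value is closed downwards, the order is the largest value plus 2, or 1 if there are no
values.

Sufficiency: a word with at least `n` letters is a walk in the de Bruijn graph on words of length
`n`, and its `(n + 1)`-profile records the initial vertex, the final vertex and the set of edges. By
Simon's lemma (`LoopsCommute.foldl_eq_of_walkEdges_eq`) this data determines the action on states as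
soon as loops at `v` act as commuting idempotents on the states `p · v`. A failure of idempotence
produces a periodic path of excess `n` (`evalFrom_loop_loop`). Without semirestricted paths of
length `n`, the states `p · vxy` and `p · vyx` reach each other; without restricted ones, they then
coincide (`evalFrom_loops_comm`).

Necessity: each path of value `n` yields two words with the same `(n + 1)`-profile acting
differently on some state, which a reduced `(n + 1)`-testable automaton forbids
(`IsReduced.evalFrom_eq_of_sameKProfile`). -/

/-- The set of edges traversed by the walk labelled by a word. -/
def walkEdges (δ : V → α → V) : V → List α → Set (V × α)
  | _, [] => ∅
  | v, c :: w => insert (v, c) (walkEdges δ (δ v c) w)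

theorem walkEdges_append (δ : V → α → V) (v : V) (u w : List α) :
    walkEdges δ v (u ++ w) = walkEdges δ v u ∪ walkEdges δ (u.foldl δ v) w := by
  induction u generalizing v with
  | nil => simp [walkEdges]
  | cons c u ih => simp [walkEdges, ih, Set.insert_union]

theorem exists_first_of_mem_walkEdges {δ : V → α → V} {v x : V} {c : α} {w : List α}
    (h : (x, c) ∈ walkEdges δ v w) :
    ∃ w₁ w₂, w = w₁ ++ c :: w₂ ∧ w₁.foldl δ v = x ∧ (x, c) ∉ walkEdges δ v w₁ := by
  classical
  induction w generalizing v with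
  | nil => simp [walkEdges] at h
  | cons d w ih =>
    by_cases hd : (x, c) = (v, d)
    · obtain ⟨rfl, rfl⟩ := Prod.mk.inj hd
      exact ⟨[], w, rfl, rfl, by simp [walkEdges]⟩
    · obtain ⟨w₁, w₂, rfl, h₁, h₂⟩ := ih (h.resolve_left hd)
      refine ⟨d :: w₁, w₂, rfl, h₁, ?_⟩
      simp only [walkEdges, Set.mem_insert_iff, not_or]
      exact ⟨hd, h₂⟩

/-- A walk starting at a vertex of another walk, and whose edges leaving vertices of that walk
all belong to that walk, has all its edges in that walk. -/
theorem walkEdges_subset_of_closed {δ : V → α → V} {z : V} {w : List α} {E : Set (V × α)}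
    (hE : ∀ w₁ w₂ d, w = w₁ ++ w₂ → (w₁.foldl δ z, d) ∈ E →
      (w₁.foldl δ z, d) ∈ walkEdges δ z w) (u : List α) :
    ∀ w₁ w₂, w = w₁ ++ w₂ → walkEdges δ (w₁.foldl δ z) u ⊆ E →
      walkEdges δ (w₁.foldl δ z) u ⊆ walkEdges δ z w := by
  induction u with
  | nil => simp [walkEdges]
  | cons d u ih =>
    intro w₁ w₂ hw hu
    have hd := hE w₁ w₂ d hw (hu (Set.mem_insert _ _))
    refine Set.insert_subset hd ?_
    obtain ⟨w₃, w₄, hw', h₃, -⟩ := exists_first_of_mem_walkEdges hd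
    have key : (w₃ ++ [d]).foldl δ z = δ (w₁.foldl δ z) d := by simp [h₃]
    have := ih (w₃ ++ [d]) w₄ (by simpa using hw')
    rw [key] at this
    exact this ((Set.subset_insert _ _).trans hu)

/-- An action of words on states over a labelled graph, in which loops act on the states lying
over their base point as commuting idempotents. -/
structure LoopsCommute (δ : V → α → V) (f : σ → α → σ) (T : σ → V → Prop) : Prop where
  step : ∀ q v c, T q v → T (f q c) (δ v c)
  idem : ∀ (q : σ) (v : V) (x : List α), T q v → x.foldl δ v = v → (x ++ x).foldl f q = x.foldl f q
  comm : ∀ (q : σ) (v : V) (x y : List α), T q v → x.foldl δ v = v → y.foldl δ v = v →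
    (x ++ y).foldl f q = (y ++ x).foldl f q

namespace LoopsCommute

variable {δ : V → α → V} {f : σ → α → σ} {T : σ → V → Prop}

theorem foldl (h : LoopsCommute δ f T) {q : σ} {v : V} (hT : T q v) (w : List α) :
    T (w.foldl f q) (w.foldl δ v) := by
  induction w generalizing q v with
  | nil => exact hT
  | cons c w ih => exact ih (h.step _ _ _ hT)

/-- Induction on `y` from its end. The last edge `c` of `y` already occurs in `x = x₁ c x₂`, so `c
x₂ y` is a loop at the end of `x₁`. By idempotence this loop may be run once more, so after `y c`
one continues with `x₂ y z`, where `z` is the return from `y`. -/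
theorem exists_return (h : LoopsCommute δ f T) {q : σ} {v : V} (hT : T q v) (x y : List α)
    (hy : walkEdges δ (x.foldl δ v) y ⊆ walkEdges δ v x) :
    ∃ z, (x ++ y ++ z).foldl f q = x.foldl f q ∧ (x ++ y ++ z).foldl δ v = x.foldl δ v := by
  induction y using List.reverseRecOn with
  | nil => exact ⟨[], by simp⟩
  | append_singleton y c ih =>
    rw [walkEdges_append] at hy
    obtain ⟨z, hz, hz'⟩ := ih (Set.subset_union_left.trans hy)
    have hc : (y.foldl δ (x.foldl δ v), c) ∈ walkEdges δ v x :=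
      hy (Or.inr (Set.mem_insert _ _))
    obtain ⟨x₁, x₂, rfl, hx, -⟩ := exists_first_of_mem_walkEdges hc
    have hl : (c :: x₂ ++ y).foldl δ (x₁.foldl δ v) = x₁.foldl δ v := by
      simpa using hx.symm
    have hi := h.idem _ _ _ (h.foldl hT x₁) hl
    simp only [List.foldl_append, List.foldl_cons, List.foldl_nil] at hi hz hz' hl ⊢
    refine ⟨x₂ ++ y ++ z, ?_, ?_⟩
    · simp only [List.foldl_append]
      rw [hi, hz]
    · simp only [List.foldl_append]
      rw [hl, hl, ← hz', hl]

/-- Let `s` be the state after `x`. A return `z` gives `s·yz = s`; then `s·y = s·yzy = s·yyz = s·yz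
= s` by commutation and idempotence. -/
theorem append_loop (h : LoopsCommute δ f T) {q : σ} {v : V} (hT : T q v) (x y : List α)
    (hl : y.foldl δ (x.foldl δ v) = x.foldl δ v)
    (hy : walkEdges δ (x.foldl δ v) y ⊆ walkEdges δ v x) :
    (x ++ y).foldl f q = x.foldl f q := by
  obtain ⟨z, hz, hz'⟩ := h.exists_return hT x y hy
  have hT' := h.foldl hT x
  simp only [List.foldl_append, hl] at hz hz' ⊢
  have hc := h.comm _ _ z y hT' hz' hl
  have hi := h.idem _ _ y hT' hl
  have hc' := h.comm _ _ z y (h.foldl hT' y) (by rw [hl, hz']) (by rw [hl, hl])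
  simp only [List.foldl_append] at hc hi hc'
  rw [hz, hi, hz] at hc'
  exact hc'

/-- The inductive step in `foldl_eq_of_walkEdges_eq`: a walk beginning with `x` can be replaced by
one beginning with `x` and the next letter of a walk with the same edges. -/
theorem exists_next (h : LoopsCommute δ f T) {q : σ} {v : V} (hT : T q v)
    {x w y : List α} {c : α}
    (hE : walkEdges δ v (x ++ w) = walkEdges δ v (x ++ c :: y)) :
    ∃ w', (x ++ c :: w').foldl f q = (x ++ w).foldl f q ∧
      (x ++ c :: w').foldl δ v = (x ++ w).foldl δ v ∧
      walkEdges δ v (x ++ c :: w') = walkEdges δ v (x ++ w) := by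
  classical
  have hTx := h.foldl hT x
  by_cases hx : (x.foldl δ v, c) ∈ walkEdges δ v x
  -- The edge is already in `x`, which therefore ends with the loop `c x₂`; repeating that loop
  -- changes nothing.
  · obtain ⟨x₁, x₂, hxx, hx₁, -⟩ := exists_first_of_mem_walkEdges hx
    have hl : (c :: x₂).foldl δ (x₁.foldl δ v) = x₁.foldl δ v := by
      rw [← List.foldl_append, ← hxx, hx₁]
    have hi := h.idem _ _ _ (h.foldl hT x₁) hl
    have hv : (x ++ c :: x₂).foldl δ v = x.foldl δ v := by
      rw [List.foldl_append, ← hx₁, hl]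
    have hs : walkEdges δ (x.foldl δ v) (c :: x₂) ⊆ walkEdges δ v x := by
      rw [← hx₁, hxx, walkEdges_append]
      exact Set.subset_union_right
    refine ⟨x₂ ++ w, ?_, ?_, ?_⟩
    · have hq : (x ++ c :: x₂).foldl f q = x.foldl f q := by
        rw [hxx]
        simpa [List.foldl_append] using hi
      rw [← List.cons_append, ← List.append_assoc, List.foldl_append, hq, List.foldl_append]
    · rw [← List.cons_append, ← List.append_assoc, List.foldl_append, hv, List.foldl_append]
    · rw [← List.cons_append, ← List.append_assoc, walkEdges_append, hv, walkEdges_append,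
        walkEdges_append, Set.union_eq_self_of_subset_right hs]
  have hw : (x.foldl δ v, c) ∈ walkEdges δ (x.foldl δ v) w := by
    have : (x.foldl δ v, c) ∈ walkEdges δ v (x ++ w) := by
      rw [hE, walkEdges_append]
      exact Or.inr (Set.mem_insert _ _)
    rw [walkEdges_append] at this
    exact this.resolve_left hx
  obtain ⟨w₁, w₂, rfl, hw₁, hcw⟩ := exists_first_of_mem_walkEdges hw
  -- The question is whether the walk, after its first use of the new edge `c`, comes back to a
  -- vertex of `x w₁`.
  by_cases hm : ∃ d g b e, x ++ w₁ = d ++ g ∧ w₂ = b ++ e ∧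
      (x ++ w₁ ++ c :: b).foldl δ v = d.foldl δ v
  · obtain ⟨d, g, b, e, hdg, rfl, hb⟩ := hm
    have hxw : (x ++ w₁).foldl δ v = x.foldl δ v := by rw [List.foldl_append, hw₁]
    have hl : (c :: b ++ g).foldl δ (x.foldl δ v) = x.foldl δ v := by
      rw [← hxw, ← List.foldl_append,
        show x ++ w₁ ++ (c :: b ++ g) = (x ++ w₁ ++ c :: b) ++ g by simp,
        List.foldl_append, hb, ← List.foldl_append, ← hdg]
    have hgl : (g ++ c :: b).foldl δ (d.foldl δ v) = d.foldl δ v := by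
      rw [← List.foldl_append, ← List.append_assoc, ← hdg, hb]
    have hi := h.idem _ _ _ (h.foldl hT d) hgl
    have hc := h.comm _ _ _ _ hTx hl hw₁
    -- If it does, `cbg` and `w₁` are loops at the end of `x`, and `x(cbg)w₁(cbe)` acts as
    -- `xw₁(cbg)(cbe) = d(gcb)(gcb)e`, hence as `d(gcb)e = xw₁cbe`.
    refine ⟨b ++ g ++ w₁ ++ c :: b ++ e, ?_, ?_, ?_⟩
    · have e₁ : x ++ c :: (b ++ g ++ w₁ ++ c :: b ++ e) =
          x ++ ((c :: b ++ g) ++ w₁) ++ (c :: b ++ e) := by simp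
      have e₂ : (x ++ (w₁ ++ (c :: b ++ g)) ++ (c :: b ++ e)) =
          d ++ ((g ++ c :: b) ++ (g ++ c :: b)) ++ e := by
        rw [← List.append_assoc x, hdg]
        simp
      have e₃ : x ++ (w₁ ++ c :: (b ++ e)) = d ++ (g ++ c :: b) ++ e := by
        rw [← List.append_assoc, hdg]
        simp
      rw [e₁, List.foldl_append, List.foldl_append (l := x), hc,
        ← List.foldl_append (l := x), ← List.foldl_append (l := x ++ (w₁ ++ (c :: b ++ g))), e₂, List.foldl_append, List.foldl_append (l := d), hi, e₃]
      simp only [List.foldl_append]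
    · have e₁ : x ++ c :: (b ++ g ++ w₁ ++ c :: b ++ e) =
          x ++ ((c :: b ++ g) ++ w₁) ++ (c :: b ++ e) := by simp
      rw [e₁, List.foldl_append, List.foldl_append (l := x), List.foldl_append (l := c :: b ++ g),
        hl, hw₁, List.foldl_append (l := x), List.foldl_append (l := w₁), hw₁]
      rfl
    · have e₁ : x ++ c :: (b ++ g ++ w₁ ++ c :: b ++ e) =
          x ++ ((c :: b ++ g) ++ (w₁ ++ (c :: b ++ e))) := by simp
      have hg : walkEdges δ ((c :: b).foldl δ (x.foldl δ v)) g ⊆ walkEdges δ v (x ++ w₁) := by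
        rw [← hxw, ← List.foldl_append, hb, hdg, walkEdges_append]
        exact Set.subset_union_right
      have e₂ : x ++ (w₁ ++ c :: (b ++ e)) = x ++ (w₁ ++ (c :: b ++ e)) := by simp
      rw [walkEdges_append] at hg
      rw [e₁, e₂, walkEdges_append, walkEdges_append (u := c :: b ++ g), hl,
        walkEdges_append (u := c :: b), walkEdges_append (u := x),
        walkEdges_append (u := w₁), hw₁, walkEdges_append (u := c :: b)]
      ext p
      have := @hg p
      simp only [Set.mem_union] at this ⊢
      tauto
  -- If it does not, an edge of `w₁` missing from `x` would have to occur in `y`. But `y` starts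
  -- where `w₂` starts and cannot leave the edges of `w₂`, so `w₂` would meet `w₁`. Hence the loop
  -- `w₁` only repeats edges of `x` and can be dropped.
  · have hsub : walkEdges δ (x.foldl δ v) w₁ ⊆ walkEdges δ v x := by
      rintro ⟨s, d⟩ hsd
      by_contra hn
      obtain ⟨r₁, r₂, rfl, hr, -⟩ := exists_first_of_mem_walkEdges hsd
      have hin : (s, d) ∈ walkEdges δ (δ (x.foldl δ v) c) y := by
        have : (s, d) ∈ walkEdges δ v (x ++ c :: y) := by
          rw [← hE, walkEdges_append, walkEdges_append]
          exact Or.inr (Or.inl hsd)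
        rw [walkEdges_append] at this
        rcases this with h' | h' | h'
        · exact absurd h' hn
        · obtain ⟨rfl, rfl⟩ := Prod.mk.inj h'
          exact absurd hsd hcw
        · exact h'
      have hclosed := walkEdges_subset_of_closed (δ := δ) (z := δ (x.foldl δ v) c) (w := w₂)
        (E := walkEdges δ v (x ++ c :: y)) ?_ y [] w₂ rfl ?_
      · obtain ⟨b, e, rfl, hb, -⟩ := exists_first_of_mem_walkEdges (hclosed hin)
        refine hm ⟨x ++ r₁, d :: r₂, b, d :: e, by simp, rfl, ?_⟩
        rw [List.foldl_append, List.foldl_append, hw₁, List.foldl_cons, hb,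
          List.foldl_append, hr]
      · intro b e d' hbe hd'
        rw [← hE, walkEdges_append, walkEdges_append, hw₁] at hd'
        have hend : ∀ k g, x ++ (r₁ ++ d :: r₂) = k ++ g →
            b.foldl δ (δ (x.foldl δ v) c) ≠ k.foldl δ v := by
          intro k g hk hk'
          refine hm ⟨k, g, b, e, hk, hbe, ?_⟩
          rw [List.foldl_append, List.foldl_append, hw₁, List.foldl_cons, hk']
        rcases hd' with h' | h' | h' | h'
        · obtain ⟨k, g, hk, hk', -⟩ := exists_first_of_mem_walkEdges h'
          exact absurd hk'.symm (hend k (d' :: g ++ (r₁ ++ d :: r₂)) (by rw [hk]; simp))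
        · obtain ⟨k, g, hk, hk', -⟩ := exists_first_of_mem_walkEdges h'
          exact absurd hk'.symm (by
            rw [← List.foldl_append]
            exact hend (x ++ k) (d' :: g) (by rw [hk]; simp))
        · exact absurd (Prod.mk.inj h').1 (hend x _ rfl)
        · exact h'
      · rw [walkEdges_append]
        exact (Set.subset_insert _ _).trans Set.subset_union_right
    have ha := h.append_loop hT x w₁ hw₁ hsub
    refine ⟨w₂, ?_, ?_, ?_⟩
    · rw [← List.append_assoc, List.foldl_append, List.foldl_append (l := x ++ w₁), ha]
    · rw [← List.append_assoc, List.foldl_append, List.foldl_append (l := x ++ w₁),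
        List.foldl_append (l := x) (l' := w₁), hw₁]
    · rw [← List.append_assoc, walkEdges_append, walkEdges_append (u := x ++ w₁),
        walkEdges_append (u := x) (w := w₁), List.foldl_append, hw₁,
        Set.union_eq_self_of_subset_right hsub]

/-- Simon's lemma: if loops act as commuting idempotents, then coterminal walks with the same
edges act equally. -/
theorem foldl_eq_of_walkEdges_eq (h : LoopsCommute δ f T) {q : σ} {v : V} (hT : T q v)
    {u w : List α} (hend : u.foldl δ v = w.foldl δ v)
    (hE : walkEdges δ v u = walkEdges δ v w) : u.foldl f q = w.foldl f q := by
  have key : ∀ x y, w = x ++ y → ∃ z, (x ++ z).foldl f q = u.foldl f q ∧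
      (x ++ z).foldl δ v = u.foldl δ v ∧ walkEdges δ v (x ++ z) = walkEdges δ v u := by
    intro x
    induction x using List.reverseRecOn with
    | nil => exact fun _ _ => ⟨u, rfl, rfl, rfl⟩
    | append_singleton x c ih =>
      intro y hy
      obtain ⟨z, h₁, h₂, h₃⟩ := ih (c :: y) (by simpa using hy)
      obtain ⟨z', h₁', h₂', h₃'⟩ := h.exists_next hT (x := x) (w := z) (y := y) (c := c)
        (by rw [h₃, hE, hy]; simp)
      exact ⟨z', by simpa using h₁'.trans h₁, by simpa using h₂'.trans h₂,
        by simpa using h₃'.trans h₃⟩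
  obtain ⟨z, h₁, h₂, h₃⟩ := key w [] (by simp)
  rw [← h₁]
  refine h.append_loop hT w z ?_ ?_
  · rw [← List.foldl_append, h₂, hend]
  · rw [hE, walkEdges_append] at h₃
    rw [← h₃]
    exact Set.subset_union_right

end LoopsCommute

end Walks

/-! ### Factors of words and the de Bruijn graph -/

section Words

variable {α : Type*}

/-- A window only one letter longer than `w` cannot meet both `x` and `y`. This is what makes factor
sets computable when words are glued along `w`. -/
theorem List.infix_append_overlap {x w y z : List α} (hz : z.length = w.length + 1) :
    z <:+: x ++ w ++ y ↔ z <:+: x ++ w ∨ z <:+: w ++ y := by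
  constructor
  · induction x with
    | nil => exact Or.inr
    | cons a x ih =>
      intro h
      rcases List.infix_cons_iff.1 h with h | h
      · left
        refine (List.prefix_of_prefix_length_le (l₃ := (a :: x) ++ w ++ y) h
          (List.prefix_append _ _) ?_).isInfix
        simp
        omega
      · exact (ih h).imp_left fun h => List.infix_cons h
  · rintro (h | h)
    · exact h.trans (List.prefix_append _ _).isInfix
    · rw [List.append_assoc]
      exact h.trans (List.suffix_append _ _).isInfix

/-- The transition function of the de Bruijn graph: append a letter and delete the first one. -/
def deBruijnStep (v : List α) (c : α) : List α := (v ++ [c]).tail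

theorem length_deBruijnStep (v : List α) (c : α) : (deBruijnStep v c).length = v.length := by
  simp [deBruijnStep]

theorem exists_append_singleton_eq_cons_deBruijnStep (v : List α) (c : α) :
    ∃ a, v ++ [c] = a :: deBruijnStep v c := by
  cases v with
  | nil => exact ⟨c, rfl⟩
  | cons a v => exact ⟨a, rfl⟩

theorem exists_append_eq_append_foldl_deBruijnStep (v w : List α) :
    ∃ u, v ++ w = u ++ w.foldl deBruijnStep v ∧ (w.foldl deBruijnStep v).length = v.length := by
  induction w generalizing v with
  | nil => exact ⟨[], by simp⟩
  | cons c w ih =>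
    obtain ⟨a, ha⟩ := exists_append_singleton_eq_cons_deBruijnStep v c
    obtain ⟨u, hu, hl⟩ := ih (deBruijnStep v c)
    refine ⟨a :: u, ?_, by rw [List.foldl_cons, hl, length_deBruijnStep]⟩
    rw [List.append_cons, ha, List.cons_append, hu]
    rfl

theorem foldl_deBruijnStep_eq_rtake (v w : List α) :
    w.foldl deBruijnStep v = (v ++ w).rtake v.length := by
  obtain ⟨u, hu, hl⟩ := exists_append_eq_append_foldl_deBruijnStep v w
  rw [hu, List.rtake, ← hl]
  simp

theorem foldl_deBruijnStep_eq_self_iff {v w : List α} :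
    w.foldl deBruijnStep v = v ↔ v <:+ v ++ w := by
  obtain ⟨u, hu, hl⟩ := exists_append_eq_append_foldl_deBruijnStep v w
  constructor
  · intro h
    rw [h] at hu
    exact ⟨u, hu.symm⟩
  · rintro ⟨x, hx⟩
    rw [hu] at hx
    exact (List.append_inj_right' hx hl.symm).symm

theorem mem_walkEdges_deBruijnStep {v w x : List α} {c : α} :
    (x, c) ∈ walkEdges deBruijnStep v w ↔ x.length = v.length ∧ x ++ [c] <:+: v ++ w := by
  induction w generalizing v with
  | nil =>
    simp only [walkEdges, Set.mem_empty_iff_false, List.append_nil, false_iff, not_and]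
    intro h h'
    have := h'.length_le
    simp at this
    omega
  | cons d w ih =>
    obtain ⟨a, ha⟩ := exists_append_singleton_eq_cons_deBruijnStep v d
    rw [walkEdges, Set.mem_insert_iff, ih, length_deBruijnStep, List.append_cons v, ha,
      List.cons_append, List.infix_cons_iff, ← List.cons_append, ← ha]
    constructor
    · rintro (h | ⟨h, h'⟩)
      · obtain ⟨rfl, rfl⟩ := Prod.mk.inj h
        exact ⟨rfl, Or.inl (List.prefix_append _ _)⟩
      · exact ⟨h, Or.inr h'⟩
    · rintro ⟨h, h' | h'⟩
      · left
        have h'' := (List.prefix_of_prefix_length_le h' (List.prefix_append (v ++ [d]) w)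
          (by simp [h])).eq_of_length (by simp [h])
        obtain ⟨rfl, hcd⟩ := List.append_inj h'' h
        rw [List.singleton_inj.1 hcd]
      · exact Or.inr ⟨h, h'⟩

theorem SameKProfile.eq_or_le_length {k : ℕ} (hk : 0 < k) {u v : List α}
    (h : SameKProfile k u v) : u = v ∨ k ≤ u.length ∧ k ≤ v.length := by
  obtain ⟨h₁, -, h₃⟩ := h
  have key : ∀ {x y : List α}, {z : List α | z <:+: x ∧ z.length = k} =
      {z : List α | z <:+: y ∧ z.length = k} → k ≤ x.length → k ≤ y.length := by
    intro x y hxy hx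
    have : x.take k ∈ {z : List α | z <:+: y ∧ z.length = k} := by
      rw [← hxy]
      exact ⟨(List.take_prefix _ _).isInfix, by simpa using hx⟩
    exact this.2 ▸ this.1.length_le
  by_cases hu : k ≤ u.length
  · exact Or.inr ⟨hu, key h₃ hu⟩
  · have hv : ¬ k ≤ v.length := fun hv => hu (key h₃.symm hv)
    left
    rwa [List.take_of_length_le (by omega), List.take_of_length_le (by omega)] at h₁

end Words

namespace DFA

variable {α σ : Type*} {M : DFA α σ}

theorem Reaches.refl (p : σ) : M.Reaches p p := ⟨[], rfl⟩

theorem Reaches.trans {p q r : σ} : M.Reaches p q → M.Reaches q r → M.Reaches p r := by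
  rintro ⟨u, rfl⟩ ⟨v, rfl⟩
  exact ⟨u ++ v, M.evalFrom_of_append _ _ _⟩

theorem reaches_evalFrom (p : σ) (w : List α) : M.Reaches p (M.evalFrom p w) := ⟨w, rfl⟩

/-! ### Upper bound -/

/-- The sequence of pairs of states obtained by reading a word from a pair of states. -/
def pairRun (M : DFA α σ) (p q : σ) (w : List α) (i : ℕ) : σ × σ :=
  (M.evalFrom p (w.take i), M.evalFrom q (w.take i))

theorem evalFrom_take_append_drop (p : σ) (w : List α) (i : ℕ) :
    M.evalFrom (M.evalFrom p (w.take i)) (w.drop i) = M.evalFrom p w := by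
  rw [← evalFrom_of_append, List.take_append_drop]

/-- Distinctness at the end suffices: states that merge stay merged. -/
theorem isPath_pairRun {p q : σ} {w : List α} (hne : M.evalFrom p w ≠ M.evalFrom q w)
    (hr : ∀ i ≤ w.length, M.Reaches (M.evalFrom p (w.take i)) (M.evalFrom q (w.take i))) :
    M.IsPath w.length (M.pairRun p q w) := by
  refine ⟨fun i hi => ⟨hr i hi, fun h => hne ?_⟩, fun i hi => ⟨w[i], ?_⟩⟩
  · simp only [pairRun] at h
    rw [← evalFrom_take_append_drop p w i, h, evalFrom_take_append_drop]
  · simp only [pairRun, pairStep, List.take_succ_eq_append_getElem hi, evalFrom_append_singleton]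

theorem evalFrom_eq_of_notMem_restrictedLengths {w : List α}
    (hn : w.length ∉ M.restrictedLengths) {p q : σ} (hpq : M.SameSCC p q)
    (hp : M.Reaches (M.evalFrom p w) p) (hq : M.Reaches (M.evalFrom q w) q) :
    M.evalFrom p w = M.evalFrom q w := by
  by_contra hne
  have hp' : ∀ i, M.Reaches (M.evalFrom p (w.take i)) p := fun i => by
    refine .trans ⟨w.drop i, ?_⟩ hp
    rw [evalFrom_take_append_drop]
  have hq' : ∀ i, M.Reaches (M.evalFrom q (w.take i)) q := fun i => by
    refine .trans ⟨w.drop i, ?_⟩ hq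
    rw [evalFrom_take_append_drop]
  refine hn ⟨_, isPath_pairRun hne fun i _ =>
    (hp' i).trans (hpq.1.trans (reaches_evalFrom _ _)), p, fun i _ => ⟨⟨reaches_evalFrom _ _, hp' i⟩,
    hpq.1.trans (reaches_evalFrom _ _), (hq' i).trans hpq.2⟩⟩

theorem reaches_step_of_notMem_semirestrictedLengths {w : List α}
    (hn : w.length ∉ M.semirestrictedLengths) {p q : σ} {c : α}
    (hpq : M.Reaches (M.evalFrom p w) (M.evalFrom q w))
    (hq : M.Reaches (M.step (M.evalFrom q w) c) q) :
    M.Reaches (M.step (M.evalFrom p w) c) (M.step (M.evalFrom q w) c) := by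
  by_contra hnr
  have hne : M.evalFrom p w ≠ M.evalFrom q w := fun h => hnr (h ▸ .refl _)
  refine hn ⟨_, isPath_pairRun hne fun i _ => ?_, c, ?_⟩
  · refine .trans ⟨w.drop i, ?_⟩ (hpq.trans (.trans ⟨[c], ?_⟩ (hq.trans (reaches_evalFrom _ _))))
    · exact evalFrom_take_append_drop p w i
    · simp
  · simpa [pairRun] using ⟨hnr, hq⟩

/-- The one-letter case is iterated with a sliding window: `w` loses its first letter `a` and gains
`c`, while the base points move to `p · a` and `q · a`, so the window length stays the same. -/
theorem reaches_evalFrom_of_notMem_semirestrictedLengths (z : List α) :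
    ∀ {w : List α}, w.length ∉ M.semirestrictedLengths → ∀ {p q : σ},
    M.Reaches (M.evalFrom p w) (M.evalFrom q w) →
    M.Reaches (M.evalFrom (M.evalFrom q w) z) q →
    M.Reaches (M.evalFrom (M.evalFrom p w) z) (M.evalFrom (M.evalFrom q w) z) := by
  induction z with
  | nil => exact fun _ _ _ h _ => h
  | cons c z ih =>
    intro w hn p q hpq hq
    have hc := reaches_step_of_notMem_semirestrictedLengths (c := c) hn hpq (.trans ⟨z, rfl⟩ hq)
    obtain ⟨a, ha⟩ := exists_append_singleton_eq_cons_deBruijnStep w c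
    have key : ∀ s, M.step (M.evalFrom s w) c = M.evalFrom (M.step s a) (deBruijnStep w c) := by
      intro s
      rw [← evalFrom_append_singleton, ha, evalFrom_cons]
    simp only [evalFrom_cons] at hq ⊢
    simp only [key] at hc hq ⊢
    exact ih (by rwa [length_deBruijnStep]) hc (hq.trans ⟨[a], by simp⟩)

/-- Write `vx = yv`. Then `vxx = yvx` has period `|x|`, and reading `vx` from `p` and from `p · y`
follows one run at two times differing by `|x|`. If the final states differed, this would be an
`|x|`-periodic path of length `|v| + |x|`. -/
theorem evalFrom_loop_loop {v x : List α} (hn : v.length ∉ M.periodicExcesses)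
    (hx : v <:+ v ++ x) (p : σ) :
    M.evalFrom p (v ++ x ++ x) = M.evalFrom p (v ++ x) := by
  rcases eq_or_ne x [] with rfl | hne
  · simp
  obtain ⟨y, hy⟩ := hx
  have hlen : y.length = x.length := by
    have := congrArg List.length hy
    simp at this
    omega
  by_contra hc
  set z := v ++ x ++ x with hz
  have hdrop : z.drop x.length = v ++ x := by
    rw [hz, ← hy, List.append_assoc, ← hlen, List.drop_left, hy]
  have hletter : ∀ i, z[i + x.length]? = (v ++ x)[i]? := fun i => by
    rw [← hdrop, List.getElem?_drop, add_comm]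
  have htake : z.take x.length = y := by
    rw [hz, ← hy, List.append_assoc, ← hlen, List.take_left]
  have hrun : ∀ i, M.evalFrom (M.evalFrom p y) ((v ++ x).take i) =
      M.evalFrom p (z.take (i + x.length)) := fun i => by
    rw [← evalFrom_of_append, add_comm, List.take_add, htake, hdrop]
  have hpre : ∀ i ≤ v.length + x.length, (v ++ x).take i = z.take i := fun i hi => by
    rw [hz, List.take_append_of_le_length (l₁ := v ++ x) (by simpa using hi)]
  have hpath := isPath_pairRun (M := M) (p := p) (q := M.evalFrom p y) (w := v ++ x)
    (by
        rw [← evalFrom_of_append, ← hdrop, ← htake, List.take_append_drop, hdrop]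
        exact fun h => hc h.symm)
    (fun i hi => by
      rw [hrun, hpre i (by simpa using hi), List.take_add]
      exact ⟨_, (evalFrom_of_append _ _ _ _).symm⟩)
  rw [List.length_append] at hpath
  refine hn ⟨x.length, _, List.length_pos_iff.2 hne, hpath, fun i hi => ?_, fun j hj => ?_⟩
  · simp only [pairRun]
    rw [hrun, hpre _ hi]
  · refine ⟨(v ++ x)[j]'(by simpa using hj), fun i hi => ?_⟩
    have hl : ∀ i, j + x.length * i < v.length + x.length →
        (v ++ x)[j + x.length * i]? = (v ++ x)[j]? := by
      intro i
      induction i with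
      | zero => simp
      | succ i ih =>
        intro hi
        rw [Nat.mul_succ, ← add_assoc] at hi ⊢
        rw [← ih (by omega), ← hletter (j + x.length * i), hz,
          List.getElem?_append_left (l₁ := v ++ x) (by simpa using hi)]
    have hi' : j + x.length * i < (v ++ x).length := by simpa using hi
    have hj' : j < (v ++ x).length := by simpa using hj
    have he := hl i hi
    rw [List.getElem?_eq_getElem hi', List.getElem?_eq_getElem hj', Option.some_inj] at he
    simp [pairRun, pairStep, List.take_succ_eq_append_getElem hi', he]

theorem exists_evalFrom_eq_of_loop {v z : List α} (hz : v <:+ v ++ z) (hne : z ≠ []) {b : σ}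
    (hb : M.evalFrom b z = b) : ∃ b', M.SameSCC b b' ∧ M.evalFrom b' v = b := by
  have key : ∀ n : ℕ, v <:+ v ++ (List.replicate n z).flatten ∧
      M.evalFrom b (List.replicate n z).flatten = b ∧
      n ≤ (List.replicate n z).flatten.length := by
    intro n
    induction n with
    | zero => simp
    | succ n ih =>
      obtain ⟨h₁, h₂, h₃⟩ := ih
      rw [List.replicate_succ', List.flatten_append]
      refine ⟨?_, ?_, ?_⟩
      · obtain ⟨y, hy⟩ := h₁
        rw [← List.append_assoc, ← hy]
        simpa using hz.trans (List.suffix_append _ _)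
      · simp [evalFrom_of_append, h₂, hb]
      · have := List.length_pos_iff.2 hne
        rw [List.length_append]
        simp only [List.flatten_cons, List.flatten_nil, List.append_nil]
        omega
  -- As `z` is nonempty, `z` repeated `|v|` times is long enough to have `v` itself as a suffix.
  obtain ⟨h₁, h₂, h₃⟩ := key v.length
  obtain ⟨u, hu⟩ := List.suffix_of_suffix_length_le h₁ (List.suffix_append _ _) h₃
  rw [← hu, evalFrom_of_append] at h₂
  exact ⟨M.evalFrom b u, ⟨⟨u, rfl⟩, ⟨v, h₂⟩⟩, h₂⟩

theorem suffix_append_append_of_loops {v x y : List α} (hx : v <:+ v ++ x) (hy : v <:+ v ++ y) :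
    v <:+ v ++ (x ++ y) := by
  obtain ⟨u, hu⟩ := hx
  rw [← List.append_assoc, ← hu, List.append_assoc]
  exact hy.trans (List.suffix_append _ _)

theorem evalFrom_evalFrom_loop_loop {v x : List α} (hn : v.length ∉ M.periodicExcesses)
    (hx : v <:+ v ++ x) {y : List α} (hy : v <:+ v ++ y) (p : σ) :
    M.evalFrom p (v ++ y ++ x ++ x) = M.evalFrom p (v ++ y ++ x) := by
  obtain ⟨u, hu⟩ := hy
  have := evalFrom_loop_loop hn hx (M.evalFrom p u)
  rw [← hu]
  simpa [← evalFrom_of_append] using this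

/-- The target `t = p · vyx` is fixed by `x` and by `yx`, so `t = b · v` for some `b` in its
component. Since `p · v` reaches `b · v`, this persists after reading `xy`, and `b · vxy = t · y`
returns to `t` by `x`. -/
theorem reaches_evalFrom_loops {v x y : List α} (hP : v.length ∉ M.periodicExcesses)
    (hS : v.length ∉ M.semirestrictedLengths)
    (hx : v <:+ v ++ x) (hy : v <:+ v ++ y) (hne : y ++ x ≠ []) (p : σ) :
    M.Reaches (M.evalFrom p (v ++ x ++ y)) (M.evalFrom p (v ++ y ++ x)) := by
  have hyx := suffix_append_append_of_loops hy hx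
  have hb : M.evalFrom (M.evalFrom p (v ++ y ++ x)) (y ++ x) = M.evalFrom p (v ++ y ++ x) := by
    simpa [← evalFrom_of_append] using evalFrom_loop_loop hP hyx p
  obtain ⟨b, ⟨hb₁, hb₂⟩, hb₃⟩ := exists_evalFrom_eq_of_loop hyx hne hb
  have hxx : M.evalFrom (M.evalFrom p (v ++ y ++ x)) x = M.evalFrom p (v ++ y ++ x) := by
    rw [← evalFrom_of_append, evalFrom_evalFrom_loop_loop hP hx hy]
  have hr : M.Reaches (M.evalFrom (M.evalFrom b v) (x ++ y)) (M.evalFrom p (v ++ y ++ x)) := by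
    rw [hb₃, evalFrom_of_append, hxx]
    exact ⟨x, by rw [← evalFrom_of_append, hb]⟩
  have := reaches_evalFrom_of_notMem_semirestrictedLengths (M := M) (x ++ y) hS (p := p) (q := b)
    (by rw [hb₃, List.append_assoc, evalFrom_of_append]; exact reaches_evalFrom _ _)
    (hr.trans hb₁)
  rw [← evalFrom_of_append, ← List.append_assoc] at this
  exact this.trans hr

theorem evalFrom_loops_comm {v x y : List α} (hP : v.length ∉ M.periodicExcesses)
    (hR : v.length ∉ M.restrictedLengths) (hS : v.length ∉ M.semirestrictedLengths)
    (hx : v <:+ v ++ x) (hy : v <:+ v ++ y) (p : σ) :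
    M.evalFrom p (v ++ x ++ y) = M.evalFrom p (v ++ y ++ x) := by
  by_cases hne : y ++ x = []
  · obtain ⟨rfl, rfl⟩ := List.append_eq_nil_iff.1 hne
    rfl
  have hne' : x ++ y ≠ [] := by
    intro h
    obtain ⟨rfl, rfl⟩ := List.append_eq_nil_iff.1 h
    exact hne rfl
  have h₁ := reaches_evalFrom_loops hP hS hx hy hne p
  have h₂ := reaches_evalFrom_loops hP hS hy hx hne' p
  have key : ∀ {x y : List α}, v <:+ v ++ x → v <:+ v ++ y → x ++ y ≠ [] →
      ∃ b, M.SameSCC (M.evalFrom p (v ++ x ++ y)) b ∧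
        M.evalFrom b v = M.evalFrom p (v ++ x ++ y) := by
    intro x y hx hy hne
    have hxy := suffix_append_append_of_loops hx hy
    exact exists_evalFrom_eq_of_loop hxy hne
      (by simpa [← evalFrom_of_append] using evalFrom_loop_loop hP hxy p)
  obtain ⟨b, ⟨hb₁, hb₂⟩, hb₃⟩ := key hx hy hne'
  obtain ⟨d, ⟨hd₁, hd₂⟩, hd₃⟩ := key hy hx hne
  rw [← hb₃, ← hd₃]
  exact evalFrom_eq_of_notMem_restrictedLengths hR
    ⟨hb₂.trans (h₁.trans hd₁), hd₂.trans (h₂.trans hb₁)⟩ (by rwa [hb₃]) (by rwa [hd₃])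

theorem loopsCommute_deBruijnStep {n : ℕ} (hP : n ∉ M.periodicExcesses)
    (hR : n ∉ M.restrictedLengths) (hS : n ∉ M.semirestrictedLengths) :
    LoopsCommute deBruijnStep M.step
      fun q (v : List α) => v.length = n ∧ ∃ p, M.evalFrom p v = q where
  step := by
    rintro _ v c ⟨hv, p, rfl⟩
    obtain ⟨a, ha⟩ := exists_append_singleton_eq_cons_deBruijnStep v c
    refine ⟨(length_deBruijnStep v c).trans hv, M.step p a, ?_⟩
    rw [← evalFrom_append_singleton, ha, evalFrom_cons]
  idem := by
    rintro _ v x ⟨rfl, p, rfl⟩ hx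
    have := evalFrom_loop_loop hP (foldl_deBruijnStep_eq_self_iff.1 hx) p
    rwa [List.append_assoc, evalFrom_of_append, evalFrom_of_append _ p v x] at this
  comm := by
    rintro _ v x y ⟨rfl, p, rfl⟩ hx hy
    have := evalFrom_loops_comm hP hR hS (foldl_deBruijnStep_eq_self_iff.1 hx)
      (foldl_deBruijnStep_eq_self_iff.1 hy) p
    rw [List.append_assoc, List.append_assoc, evalFrom_of_append _ p v (x ++ y),
      evalFrom_of_append _ p v (y ++ x)] at this
    exact this

/-- An automaton without paths of value `n` of any of the three kinds is `(n + 1)`-testable. -/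
theorem isKTestable_of_notMem {n : ℕ} (hP : n ∉ M.periodicExcesses)
    (hR : n ∉ M.restrictedLengths) (hS : n ∉ M.semirestrictedLengths) :
    M.IsKTestable (n + 1) := by
  refine ⟨n.succ_pos, fun u v _ _ h => ?_⟩
  rcases h.eq_or_le_length n.succ_pos with rfl | ⟨hu, hv⟩
  · rfl
  obtain ⟨h₁, h₂, h₃⟩ := h
  rw [Nat.add_sub_cancel] at h₁ h₂
  obtain ⟨t, x, rfl, ht⟩ : ∃ t x, u = t ++ x ∧ t.length = n :=
    ⟨u.take n, u.drop n, by simp, by simp; omega⟩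
  obtain ⟨s, y, rfl, hs⟩ : ∃ s y, v = s ++ y ∧ s.length = n :=
    ⟨v.take n, v.drop n, by simp, by simp; omega⟩
  rw [← ht, List.take_left, ht, ← hs, List.take_left] at h₁
  subst h₁
  have key := (loopsCommute_deBruijnStep hP hR hS).foldl_eq_of_walkEdges_eq
    (q := M.evalFrom M.start t) (v := t) (u := x) (w := y) ⟨ht, _, rfl⟩
    (by rw [foldl_deBruijnStep_eq_rtake, foldl_deBruijnStep_eq_rtake, ht, h₂])
    (by
      ext ⟨z, c⟩
      rw [mem_walkEdges_deBruijnStep, mem_walkEdges_deBruijnStep, ht]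
      refine and_congr_right fun hz => ?_
      simpa [hz] using Set.ext_iff.1 h₃ (z ++ [c]))
  have key' : M.evalFrom M.start (t ++ x) = M.evalFrom M.start (t ++ y) := by
    rw [evalFrom_of_append, evalFrom_of_append]
    exact key
  change M.evalFrom M.start _ ∈ M.accept ↔ M.evalFrom M.start _ ∈ M.accept
  rw [key']

end DFA

/-! ### Words with the same profile -/

section Profile

variable {α : Type*} {k : ℕ} {u v : List α}

theorem SameKProfile.reverse (h : SameKProfile k u v) :
    SameKProfile k u.reverse v.reverse := by
  obtain ⟨h₁, h₂, h₃⟩ := h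
  refine ⟨?_, ?_, ?_⟩
  · simpa [List.rtake_eq_reverse_take_reverse] using h₂
  · simpa [List.rtake_eq_reverse_take_reverse] using h₁
  · ext z
    have := Set.ext_iff.1 h₃ z.reverse
    simpa [← List.reverse_infix (l₂ := u.reverse), ← List.reverse_infix (l₂ := v.reverse)]
      using this

/-- For words of length at least `k`, the suffix is unchanged and the only possible new factor is
the prefix of length `k`, which the old prefix of length `k - 1` determines. -/
theorem SameKProfile.cons (hk : 0 < k) (h : SameKProfile k u v) (a : α) :
    SameKProfile k (a :: u) (a :: v) := by
  rcases h.eq_or_le_length hk with rfl | ⟨hu, hv⟩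
  · exact ⟨rfl, rfl, rfl⟩
  obtain ⟨k, rfl⟩ := Nat.exists_eq_succ_of_ne_zero hk.ne'
  obtain ⟨h₁, h₂, h₃⟩ := h
  simp only [Nat.succ_eq_add_one, Nat.add_sub_cancel] at *
  have hsuf : ∀ {w : List α}, k + 1 ≤ w.length → (a :: w).rtake k = w.rtake k := by
    intro w hw
    rw [List.rtake, List.rtake, List.length_cons,
      show w.length + 1 - k = (w.length - k) + 1 by omega, List.drop_succ_cons]
  refine ⟨?_, by rw [Nat.add_sub_cancel, hsuf hu, hsuf hv, h₂], ?_⟩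
  · rw [Nat.add_sub_cancel]
    cases k with
    | zero => simp
    | succ k =>
      rw [List.take_succ_cons, List.take_succ_cons]
      have := congrArg (List.take k) h₁
      simp only [List.take_take] at this
      simpa using this
  · ext z
    simp only [Set.mem_ofPred_eq, and_congr_left_iff]
    intro hz
    have h₃' := Set.ext_iff.1 h₃ z
    simp only [Set.mem_ofPred_eq, hz, and_true] at h₃'
    rw [List.infix_cons_iff, List.infix_cons_iff, h₃', List.prefix_iff_eq_take,
      List.prefix_iff_eq_take, hz, List.take_succ_cons, List.take_succ_cons, h₁]

theorem SameKProfile.append_left (hk : 0 < k) (h : SameKProfile k u v) (x : List α) :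
    SameKProfile k (x ++ u) (x ++ v) := by
  induction x with
  | nil => exact h
  | cons a x ih => exact ih.cons hk a

theorem SameKProfile.append_right (hk : 0 < k) (h : SameKProfile k u v) (x : List α) :
    SameKProfile k (u ++ x) (v ++ x) := by
  simpa using (h.reverse.append_left hk x.reverse).reverse

theorem sameKProfile_of_overlap {w : List α} (hu : w <+: u) (hv : w <+: v) (hu' : w <:+ u)
    (hv' : w <:+ v) (h : ∀ z : List α, z.length = w.length + 1 → (z <:+: u ↔ z <:+: v)) :
    SameKProfile (w.length + 1) u v := by
  have hs : ∀ {x : List α}, w <:+ x → x.rtake w.length = w := by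
    rintro _ ⟨y, rfl⟩
    simp [List.rtake]
  refine ⟨?_, ?_, ?_⟩
  · rw [Nat.add_sub_cancel, ← List.prefix_iff_eq_take.1 hu, ← List.prefix_iff_eq_take.1 hv]
  · rw [Nat.add_sub_cancel, hs hu', hs hv']
  · ext z
    simpa using h z

end Profile

namespace DFA

variable {α σ : Type*} {M : DFA α σ}

/-! ### Lower bounds -/

theorem IsReduced.evalFrom_eq_of_sameKProfile (hred : M.IsReduced) {k : ℕ} (hM : M.IsKTestable k)
    {u v : List α} (hu : u ≠ []) (hv : v ≠ []) (h : SameKProfile k u v) (p : σ) :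
    M.evalFrom p u = M.evalFrom p v := by
  obtain ⟨x, rfl⟩ := hred.1 p
  apply hred.2
  ext y
  have := hM.2 (x ++ u ++ y) (x ++ v ++ y) (by simp [hu]) (by simp [hv])
    ((h.append_left hM.1 x).append_right hM.1 y)
  simpa [mem_accepts, mem_acceptsFrom, eval, evalFrom_of_append] using this

theorem IsPath.exists_word {n : ℕ} {x : ℕ → σ × σ} (h : M.IsPath n x) :
    ∃ w : List α, w.length = n ∧ M.evalFrom (x 0).1 w = (x n).1 ∧
      M.evalFrom (x 0).2 w = (x n).2 := by
  induction n with
  | zero => exact ⟨[], rfl, rfl, rfl⟩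
  | succ n ih =>
    obtain ⟨w, hw, h₁, h₂⟩ := ih ⟨fun i hi => h.1 i (by omega), fun i hi => h.2 i (by omega)⟩
    obtain ⟨c, hc⟩ := h.2 n n.lt_succ_self
    refine ⟨w ++ [c], by simp [hw], ?_, ?_⟩
    · rw [evalFrom_append_singleton, h₁, ← hc, pairStep]
    · rw [evalFrom_append_singleton, h₂, ← hc, pairStep]

theorem IsReduced.not_isKTestable_of_mem_restrictedLengths (hred : M.IsReduced) {n : ℕ}
    (hn : n ∈ M.restrictedLengths) : ¬ M.IsKTestable (n + 1) := by
  intro hM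
  obtain ⟨x, hx, s, hs⟩ := hn
  obtain ⟨w, rfl, h₁, h₂⟩ := hx.exists_word
  have h0 := (hx.1 0 (Nat.zero_le _)).2
  have hne := (hx.1 w.length le_rfl).2
  obtain ⟨⟨hs₁, -⟩, hs₂, -⟩ := hs 0 (Nat.zero_le _)
  obtain ⟨⟨-, ht₁⟩, -, ht₂⟩ := hs w.length le_rfl
  obtain ⟨a, ha⟩ := ht₁.trans hs₂
  obtain ⟨b, hb⟩ := ht₂.trans hs₁
  -- Testability compares nonempty words only.
  have hnil : ¬ (w = [] ∧ a = []) := by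
    rintro ⟨rfl, rfl⟩
    exact h0 (h₁.trans ha)
  refine hne ?_
  -- With `w : (p, q) ↦ (p', q')`, `a : p' ↦ q` and `b : q' ↦ p`, the words `wawbw` and `wawbwaw`
  -- send `p` to `p'` and to `q'`.
  have key := hred.evalFrom_eq_of_sameKProfile hM (u := w ++ a ++ w ++ (b ++ w))
    (v := w ++ a ++ w ++ b ++ w ++ (a ++ w)) (by simp; tauto) (by simp; tauto)
    (sameKProfile_of_overlap (by simp [List.append_assoc]) (by simp [List.append_assoc])
      ⟨w ++ a ++ w ++ b, by simp⟩ ⟨w ++ a ++ w ++ b ++ w ++ a, by simp⟩ fun z hz => ?_) (x 0).1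
  · simpa [evalFrom_of_append, h₁, h₂, ha, hb] using key
  · rw [List.infix_append_overlap hz, List.infix_append_overlap hz,
      show w ++ a ++ w ++ b ++ w = w ++ a ++ w ++ (b ++ w) by simp, List.infix_append_overlap hz,
      ← List.append_assoc w a w, ← List.append_assoc w b w]
    tauto

theorem IsReduced.not_isKTestable_of_mem_semirestrictedLengths (hred : M.IsReduced) {n : ℕ}
    (hn : n ∈ M.semirestrictedLengths) : ¬ M.IsKTestable (n + 1) := by
  intro hM
  obtain ⟨x, hx, c, hc, b, hb⟩ := hn
  obtain ⟨w, rfl, h₁, h₂⟩ := hx.exists_word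
  obtain ⟨a, ha⟩ := (hx.1 w.length le_rfl).1
  -- With `w : (p, q) ↦ (p', q')`, `a : p' ↦ q'` and `cb : q' ↦ q`, the first word sends `p` to
  -- `q'`, while the second passes through `p' · c`; equality would let `p' · c` reach `q'`, hence
  -- `q' · c`.
  have key := hred.evalFrom_eq_of_sameKProfile hM (u := w ++ (a ++ c :: b) ++ w ++ (c :: b ++ w))
    (v := w ++ c :: b ++ w ++ (a ++ c :: b ++ w)) (by simp) (by simp)
    (sameKProfile_of_overlap (by simp [List.append_assoc]) (by simp [List.append_assoc])
      ⟨w ++ (a ++ c :: b) ++ w ++ c :: b, by simp⟩ ⟨w ++ c :: b ++ w ++ (a ++ c :: b), by simp⟩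
      fun z hz => ?_) (x 0).1
  · refine hc (.trans (q := (x w.length).2) ⟨b ++ w ++ (a ++ c :: b ++ w), ?_⟩ ⟨[c], by simp⟩)
    simpa [evalFrom_of_append, h₁, h₂, ha, hb] using key.symm
  · rw [List.infix_append_overlap hz, List.infix_append_overlap hz,
      ← List.append_assoc w (c :: b) w, ← List.append_assoc w (a ++ c :: b) w, or_comm]

theorem IsReduced.not_isKTestable_of_mem_periodicExcesses (hred : M.IsReduced) {n : ℕ}
    (hn : n ∈ M.periodicExcesses) : ¬ M.IsKTestable (n + 1) := by
  intro hM
  obtain ⟨r, x, hr, hx, hper, hlet⟩ := hn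
  have : Nonempty α := let ⟨c, _⟩ := hlet 0 (by omega); ⟨c⟩
  choose! c hc using hlet
  have hstep : ∀ i < n + r, M.pairStep (x i) (c (i % r)) = x (i + 1) := by
    intro i hi
    have := hc (i % r) ((Nat.mod_le _ _).trans_lt hi) (i / r) (by rwa [Nat.mod_add_div])
    rwa [Nat.mod_add_div] at this
  -- `P m` is the label of the first `m` steps, continued periodically. The words compared are `P (n
  -- + r)` and `P (n + 2r)`, which lead from the first component of `x 0` to the two components of
  -- the last node.
  set P : ℕ → List α := fun m => (List.range m).map fun i => c (i % r) with hP
  have hadd : ∀ m, P (r + m) = P r ++ P m := by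
    intro m
    simp [hP, List.range_add, Function.comp_def]
  have hsucc : ∀ m, P (m + 1) = P m ++ [c (m % r)] := by
    intro m
    simp [hP, List.range_succ]
  have hrun : ∀ m ≤ n + r, M.evalFrom (x 0).1 (P m) = (x m).1 ∧
      M.evalFrom (x 0).2 (P m) = (x m).2 := by
    intro m
    induction m with
    | zero => simp [hP]
    | succ m ih =>
      intro hm
      obtain ⟨h₁, h₂⟩ := ih (by omega)
      rw [hsucc, evalFrom_append_singleton, evalFrom_append_singleton, h₁, h₂,
        ← hstep m (by omega)]
      exact ⟨rfl, rfl⟩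
  have hpre : ∀ m l, P m <+: P (m + l) := by
    intro m l
    simp [hP, List.range_add]
  have hlen : (P n).length = n := by simp [hP]
  obtain ⟨y, hy⟩ := hpre n r
  have hne : P r ≠ [] := by
    rw [← List.length_pos_iff]
    simpa [hP] using hr
  have hprof : SameKProfile ((P n).length + 1) (P (n + r)) (P r ++ P (n + r)) := by
    refine sameKProfile_of_overlap (hpre n r) ?_ ?_ ?_ fun z hz => ?_
    · rw [← hadd, show r + (n + r) = n + (r + r) by omega]
      exact hpre _ _
    · rw [add_comm, hadd]
      exact List.suffix_append _ _
    · rw [add_comm n, hadd, ← List.append_assoc]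
      exact List.suffix_append _ _
    · rw [← hy, ← List.append_assoc, List.infix_append_overlap hz, hy, ← hadd, add_comm r n,
        or_self]
  rw [hlen] at hprof
  have key := hred.evalFrom_eq_of_sameKProfile hM
    (by rw [add_comm, hadd]; simp [hne]) (by simp [hne]) hprof (x 0).1
  have hr₀ := hper 0 (by omega)
  rw [zero_add] at hr₀
  rw [evalFrom_of_append, (hrun _ le_rfl).1, (hrun r (by omega)).1, hr₀, (hrun _ le_rfl).2] at key
  exact (hx.1 _ le_rfl).2 key

/-! ### Shortening paths, and the exact criterion -/

theorem restrictedLengths_mem_of_le {m n : ℕ} (h : m ≤ n) (hn : n ∈ M.restrictedLengths) :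
    m ∈ M.restrictedLengths := by
  obtain ⟨x, hx, s, hs⟩ := hn
  exact ⟨x, ⟨fun i hi => hx.1 i (hi.trans h), fun i hi => hx.2 i (hi.trans_le h)⟩, s,
    fun i hi => hs i (hi.trans h)⟩

theorem semirestrictedLengths_mem_of_le {m n : ℕ} (h : m ≤ n)
    (hn : n ∈ M.semirestrictedLengths) : m ∈ M.semirestrictedLengths := by
  obtain ⟨x, hx, c, hc, hq⟩ := hn
  obtain ⟨d, rfl⟩ := Nat.exists_eq_add_of_le' h
  have hd : M.IsPath d x :=
    ⟨fun i hi => hx.1 i (by omega), fun i hi => hx.2 i (by omega)⟩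
  obtain ⟨w, -, -, hw⟩ := hd.exists_word
  -- The condition concerns the last node, so the final segment is kept; the path itself leads to
  -- its new first node.
  refine ⟨fun i => x (d + i), ⟨fun i hi => hx.1 _ (by omega), fun i hi => hx.2 _ (by omega)⟩,
    c, hc, hq.trans ⟨w, hw⟩⟩

theorem periodicExcesses_mem_of_le {m n : ℕ} (h : m ≤ n) (hn : n ∈ M.periodicExcesses) :
    m ∈ M.periodicExcesses := by
  obtain ⟨r, x, hr, hx, hper, hlet⟩ := hn
  refine ⟨r, x, hr, ⟨fun i hi => hx.1 i (by omega), fun i hi => hx.2 i (by omega)⟩,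
    fun i hi => hper i (by omega), fun j hj => ?_⟩
  obtain ⟨c, hc⟩ := hlet j (by omega)
  exact ⟨c, fun i hi => hc i (by omega)⟩

/-- The numbers attached to paths of one of the three kinds. -/
def pathValues (M : DFA α σ) : Set ℕ :=
  M.periodicExcesses ∪ M.restrictedLengths ∪ M.semirestrictedLengths

theorem pathValues_mem_of_le {m n : ℕ} (h : m ≤ n) (hn : n ∈ M.pathValues) :
    m ∈ M.pathValues := by
  rcases hn with (hn | hn) | hn
  · exact Or.inl (Or.inl (periodicExcesses_mem_of_le h hn))
  · exact Or.inl (Or.inr (restrictedLengths_mem_of_le h hn))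
  · exact Or.inr (semirestrictedLengths_mem_of_le h hn)

/-- A reduced automaton is `(n + 1)`-testable if and only if `n` is not the value of a path of any
of the three kinds. -/
theorem IsReduced.isKTestable_succ_iff (hred : M.IsReduced) {n : ℕ} :
    M.IsKTestable (n + 1) ↔ n ∉ M.pathValues := by
  constructor
  · rintro hM ((h | h) | h)
    · exact hred.not_isKTestable_of_mem_periodicExcesses h hM
    · exact hred.not_isKTestable_of_mem_restrictedLengths h hM
    · exact hred.not_isKTestable_of_mem_semirestrictedLengths h hM
  · intro h
    simp only [pathValues, Set.mem_union, not_or] at h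
    exact isKTestable_of_notMem h.1.1 h.1.2 h.2

end DFA

/-- The maxima in the theorem exist, as the three sets of natural numbers are bounded; an empty
set has supremum `0` in `ℕ`, so a family without paths does not contribute to the maximum. If
there are no paths of any of the three kinds, the order of local testability is `1`. -/
theorem theorem4p3 {α σ : Type*} [Finite σ] (M : DFA α σ)
    (hred : M.IsReduced) (hlt : M.IsLocallyTestable) :
    BddAbove M.periodicExcesses ∧
    BddAbove M.restrictedLengths ∧
    BddAbove M.semirestrictedLengths ∧
    ((M.periodicExcesses ∪ M.restrictedLengths ∪ M.semirestrictedLengths).Nonempty →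
      M.IsPreciselyTestable
        (max (sSup M.periodicExcesses)
          (max (sSup M.restrictedLengths) (sSup M.semirestrictedLengths)) + 2)) ∧
    (M.periodicExcesses ∪ M.restrictedLengths ∪ M.semirestrictedLengths = ∅ →
      M.IsPreciselyTestable 1) := by
  have hbdd : BddAbove M.pathValues := by
    obtain ⟨k, hk⟩ := hlt
    obtain ⟨n, rfl⟩ := Nat.exists_eq_succ_of_ne_zero hk.1.ne'
    exact ⟨n, fun m hm => le_of_not_ge fun h =>
      hred.isKTestable_succ_iff.1 hk (DFA.pathValues_mem_of_le h hm)⟩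
  have hP : BddAbove M.periodicExcesses := hbdd.mono fun _ h => Or.inl (Or.inl h)
  have hR : BddAbove M.restrictedLengths := hbdd.mono fun _ h => Or.inl (Or.inr h)
  have hS : BddAbove M.semirestrictedLengths := hbdd.mono fun _ h => Or.inr h
  refine ⟨hP, hR, hS, fun hne => ?_, fun hempty => ?_⟩
  · set N := max (sSup M.periodicExcesses)
      (max (sSup M.restrictedLengths) (sSup M.semirestrictedLengths)) with hN
    have hle : ∀ m ∈ M.pathValues, m ≤ N := by
      rintro m ((h | h) | h)
      · exact (le_csSup hP h).trans (le_max_left _ _)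
      · exact (le_csSup hR h).trans ((le_max_left _ _).trans (le_max_right _ _))
      · exact (le_csSup hS h).trans ((le_max_right _ _).trans (le_max_right _ _))
    -- An empty family contributes the default supremum `0`, which is itself a value by downward
    -- closure.
    have hmem : N ∈ M.pathValues := by
      have hsup : ∀ {s : Set ℕ}, BddAbove s → s ⊆ M.pathValues → sSup s ∈ M.pathValues := by
        intro s hs hsub
        rcases s.eq_empty_or_nonempty with rfl | h
        · rw [csSup_empty]
          obtain ⟨m, hm⟩ := hne
          exact DFA.pathValues_mem_of_le (Nat.zero_le m) hm
        · exact hsub (Nat.sSup_mem h hs)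
      have hmax : ∀ {a b : ℕ}, a ∈ M.pathValues → b ∈ M.pathValues → max a b ∈ M.pathValues := by
        intro a b ha hb
        rcases max_choice a b with h | h <;> rwa [h]
      exact hmax (hsup hP fun _ h => Or.inl (Or.inl h))
        (hmax (hsup hR fun _ h => Or.inl (Or.inr h)) (hsup hS fun _ h => Or.inr h))
    refine ⟨hred.isKTestable_succ_iff.2 fun h => by have := hle _ h; omega, fun k hk => ?_⟩
    obtain ⟨n, rfl⟩ := Nat.exists_eq_succ_of_ne_zero hk.1.ne'
    by_contra hlt'
    exact hred.isKTestable_succ_iff.1 hk (DFA.pathValues_mem_of_le (by omega) hmem)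
  · refine ⟨hred.isKTestable_succ_iff.2 ?_, fun k hk => hk.1⟩
    rw [DFA.pathValues, hempty]
    exact Set.notMem_empty _
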